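/- Fix an integer $b\ge 2$. In the $b$-ary model, random networks (directed multigraphs with a source and a sink) of size $n=1,2,\dots$ grow as follows. The network of size $1$ is a single edge from the source to the sink. Given the network of size $n-1$ (that is, with $n-1$ edges), choose one of its edges $e=(x,y)$ uniformly at random. If the out-degree of $x$ is less than $b$, insert a further edge $(x,y)$; otherwise replace $e$ by two edges $(x,z)$ and $(z,y)$, where $z$ is a new node. The result is the network of size $n$. Let $L_n$ be the length (number of edges) of a random source-to-sink path in the random network of size $n$, where the path starts at the source and in each node follows one of the outgoing edges, chosen uniformly at random, until it reaches the sink. For $x\in\mathbb{C}\setminus\{-1,-2,\dots\}$ and $m\in\mathbb{N}$ write $H_{x+m}-H_x:=\sum_{k=1}^{m}\frac{1}{x+k}$, and let $\lambda^{\overline{b}}:=\lambda(\lambda+1)\cdots(\lambda+b-1)$. **Theorem.** The characteristic equation $\lambda^{\overline{b}}=(b-1)!$ has exactly $b$ different roots $\lambda_1,\dots,\lambda_b\in\mathbb{C}$, all of them simple. It has exactly one positive real root, which lies in $(0,1)$ and is denoted by $\lambda_1$. No $\lambda_i$ is one of $-1,\dots,-(b-1)$, the numbers $1+\lambda_i(H_{\lambda_i+b-1}-H_{\lambda_i})$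 are all nonzero, and, for all $n\ge 1$, the expectation of $L_n$ exists and satisfies $$\mathbb{E}(L_n)=\sum_{i=1}^{b}\frac{1}{1+\lambda_i\,(H_{\lambda_i+b-1}-H_{\lambda_i})}\binom{n+\lambda_i-1}{n-1}.$$ Moreover, as $n\to\infty$, $$\mathbb{E}(L_n)\sim\frac{1}{1+\lambda_1\,(H_{\lambda_1+b-1}-H_{\lambda_1})}\cdot\frac{n^{\lambda_1}}{\Gamma(\lambda_1+1)}.$$ -/

import Mathlib

/-- A directed multigraph with `n` labelled edges, whose nodes are named by natural numbers.
The edge with label `j ∈ {1, …, n}` is `j - 1 : Fin n`. -/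
structure Network (n : ℕ) where
  /-- the node at which an edge starts -/
  tail : Fin n → ℕ
  /-- the node at which an edge ends -/
  head : Fin n → ℕ

namespace Network

/-- The name of the source. -/
abbrev source : ℕ := 0

/-- The name of the sink. -/
abbrev sink : ℕ := 1

/-- The edges going out of the node `v`. -/
def outEdges {n : ℕ} (G : Network n) (v : ℕ) : Finset (Fin n) :=
  Finset.univ.filter fun e => G.tail e = v

/-- The out-degree of the node `v`. -/
def outDegree {n : ℕ} (G : Network n) (v : ℕ) : ℕ := (G.outEdges v).card

/-- The network consisting of a single edge from the source to the sink. -/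
def single : Network 1 where
  tail _ := source
  head _ := sink

/-- Parallel doubling of the edge `j = (x, y)`: a further edge `(x, y)` is inserted,
which gets the new label. -/
def parallel {n : ℕ} (G : Network n) (j : Fin n) : Network (n + 1) where
  tail := Fin.snoc (α := fun _ => ℕ) G.tail (G.tail j)
  head := Fin.snoc (α := fun _ => ℕ) G.head (G.head j)

/-- Serial doubling of the edge `j = (x, y)`: it is replaced by `(x, z)` and `(z, y)`, where `z` is
a new node, `(x, z)` keeps the label of `j`, and `(z, y)` gets the new label.
The new node is named by the new label `n + 1`. -/
def serial {n : ℕ} (G : Network n) (j : Fin n) : Network (n + 1) where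
  tail := Fin.snoc (α := fun _ => ℕ) G.tail (n + 1)
  head := Fin.snoc (α := fun _ => ℕ) (fun i => if i = j then n + 1 else G.head i) (G.head j)

/-- The `b`-ary saturation rule applied to the edge `j = (x, y)`: parallel doubling if the
out-degree of `x` is less than `b`, serial doubling otherwise. -/
def grow (b : ℕ) {n : ℕ} (G : Network n) (j : Fin n) : Network (n + 1) :=
  if G.outDegree (G.tail j) < b then G.parallel j else G.serial j

/-- The law of the random network of size `n` (number of edges) in the `b`-ary model: start with a
single edge, and in each step apply the `b`-ary rule to an edge chosen uniformly at random.
(The value at size `0` is the empty network and has no meaning.) -/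
noncomputable def random (b : ℕ) : (n : ℕ) → PMF (Network n)
  | 0 => PMF.pure ⟨Fin.elim0, Fin.elim0⟩
  | 1 => PMF.pure single
  | n + 2 => (random b (n + 1)).bind fun G =>
      (PMF.uniformOfFintype (Fin (n + 1))).map fun j => G.grow b j

open Classical in
/-- The random walk of at most `k` steps that starts at the node `v` and that follows an outgoing
edge chosen uniformly at random, until it is at the sink; it is recorded as the list of the edges
that it uses. -/
noncomputable def randomWalk {n : ℕ} (G : Network n) : (k : ℕ) → (v : ℕ) → PMF (List (Fin n))
  | 0, _ => PMF.pure []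
  | k + 1, v =>
      if h : v ≠ sink ∧ (G.outEdges v).Nonempty then
        (PMF.uniformOfFinset (G.outEdges v) h.2).bind fun e =>
          (randomWalk G k (G.head e)).map fun l => e :: l
      else PMF.pure []

/-- The random source-to-sink path in `G`. The bound on the number of steps by the number of
edges plays no role, see `isWalk_of_mem_support_randomPath`. -/
noncomputable def randomPath {n : ℕ} (G : Network n) : PMF (List (Fin n)) :=
  G.randomWalk n source

/-- The law of the length `L_n` (number of edges) of a random source-to-sink path in a random
network of size `n` in the `b`-ary model. -/
noncomputable def pathLengthLaw (b n : ℕ) : PMF ℕ :=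
  (random b n).bind fun G => G.randomPath.map List.length

/-- The list of edges `l` is a directed walk from the node `v` to the node `w`. -/
def IsWalk {n : ℕ} (G : Network n) : (v : ℕ) → (l : List (Fin n)) → (w : ℕ) → Prop
  | v, [], w => v = w
  | v, e :: l, w => G.tail e = v ∧ IsWalk G (G.head e) l w

/-- Auxiliary invariant of the growth process, used only to check that the random path always ends
at the sink: the network is acyclic, with a height function bounded by the size, and no node other
than the sink is a dead end. -/
def Good {n : ℕ} (G : Network n) : Prop :=
  (∃ h : ℕ → ℕ, (∀ e, h (G.head e) < h (G.tail e)) ∧ ∀ v, h v ≤ n) ∧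
  (∀ e, G.tail e ≤ n) ∧ (∀ e, G.head e ≤ n) ∧ (∃ e, G.tail e = source) ∧
  ∀ e, G.head e ≠ sink → ∃ e', G.tail e' = G.head e

theorem good_grow {b n : ℕ} (G : Network n) (hG : G.Good) (j : Fin n) :
    (G.grow b j).Good := by
  obtain ⟨⟨h, hlt, hle⟩, ht, hh, ⟨e₀, he₀⟩, hout⟩ := hG
  unfold grow
  split_ifs with hb
  · refine ⟨⟨h, ?_, fun v => (hle v).trans (Nat.le_succ n)⟩, ?_, ?_, ⟨e₀.castSucc, ?_⟩, ?_⟩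
    · intro e
      refine Fin.lastCases ?_ (fun i => ?_) e
      · simpa [parallel] using hlt j
      · simpa [parallel] using hlt i
    · intro e
      refine Fin.lastCases ?_ (fun i => ?_) e
      · simpa [parallel] using (ht j).trans (Nat.le_succ n)
      · simpa [parallel] using (ht i).trans (Nat.le_succ n)
    · intro e
      refine Fin.lastCases ?_ (fun i => ?_) e
      · simpa [parallel] using (hh j).trans (Nat.le_succ n)
      · simpa [parallel] using (hh i).trans (Nat.le_succ n)
    · simpa [parallel] using he₀
    · intro e
      refine Fin.lastCases (fun hs => ?_) (fun i hs => ?_) e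
      · obtain ⟨e', he'⟩ := hout j (by simpa [parallel] using hs)
        exact ⟨e'.castSucc, by simpa [parallel] using he'⟩
      · obtain ⟨e', he'⟩ := hout i (by simpa [parallel] using hs)
        exact ⟨e'.castSucc, by simpa [parallel] using he'⟩
  · refine ⟨⟨fun v => if v = n + 1 then h (G.head j) + 1 else
      if h (G.head j) < h v then h v + 1 else h v, ?_, ?_⟩, ?_, ?_, ⟨e₀.castSucc, ?_⟩, ?_⟩
    · intro e
      have hT : ∀ i, G.tail i ≠ n + 1 := fun i => by have := ht i; omega
      have hH : ∀ i, G.head i ≠ n + 1 := fun i => by have := hh i; omega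
      refine Fin.lastCases ?_ (fun i => ?_) e
      · simp [serial, hH j]
      · by_cases hij : i = j
        · subst hij
          have := hlt i
          simp [serial, hT, this]
        · have := hlt i
          simp only [serial, Fin.snoc_castSucc, hij, hT, hH, if_false]
          split_ifs <;> omega
    · intro v
      have := hle v
      have := hle (G.head j)
      dsimp only
      split_ifs <;> omega
    · intro e
      refine Fin.lastCases ?_ (fun i => ?_) e
      · simp [serial]
      · simpa [serial] using (ht i).trans (Nat.le_succ n)
    · intro e
      refine Fin.lastCases ?_ (fun i => ?_) e
      · simpa [serial] using (hh j).trans (Nat.le_succ n)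
      · by_cases hij : i = j
        · subst hij; simp [serial]
        · simpa [serial, hij] using (hh i).trans (Nat.le_succ n)
    · simpa [serial] using he₀
    · intro e
      refine Fin.lastCases (fun hs => ?_) (fun i hs => ?_) e
      · obtain ⟨e', he'⟩ := hout j (by simpa [serial] using hs)
        exact ⟨e'.castSucc, by simpa [serial] using he'⟩
      · by_cases hij : i = j
        · subst hij
          exact ⟨Fin.last n, by simp [serial]⟩
        · obtain ⟨e', he'⟩ := hout i
            (by simpa [serial, hij] using hs)
          exact ⟨e'.castSucc, by simpa [serial, hij] using he'⟩

theorem good_of_mem_support {b n : ℕ} (hn : 1 ≤ n) {G : Network n}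
    (hG : G ∈ (random b n).support) : G.Good := by
  induction n, hn using Nat.le_induction with
  | base =>
    have : G = single := by simpa [random] using hG
    subst this
    exact ⟨⟨fun v => 1 - v, by simp [single], by simp⟩, by simp [single], by simp [single],
      by simp [single], by simp [single]⟩
  | succ n hn ih =>
    obtain ⟨m, rfl⟩ : ∃ m, n = m + 1 := ⟨n - 1, by omega⟩
    rw [random, PMF.mem_support_bind_iff] at hG
    obtain ⟨G', hG', hG⟩ := hG
    rw [PMF.mem_support_map_iff] at hG
    obtain ⟨j, -, rfl⟩ := hG
    exact good_grow G' (ih hG') j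

theorem isWalk_of_height {n : ℕ} (G : Network n) (h : ℕ → ℕ)
    (hlt : ∀ e, h (G.head e) < h (G.tail e))
    (hout : ∀ e, G.head e ≠ sink → ∃ e', G.tail e' = G.head e) (k : ℕ) :
    ∀ v, h v ≤ k → (v ≠ sink → ∃ e, G.tail e = v) →
      ∀ l ∈ (G.randomWalk k v).support, G.IsWalk v l sink := by
  induction k with
  | zero =>
    intro v hv hs l hl
    have : l = [] := by simpa [randomWalk] using hl
    subst this
    by_contra hne
    obtain ⟨e, rfl⟩ := hs hne
    have := hlt e
    omega
  | succ k ih =>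
    intro v hv hs l hl
    rw [randomWalk] at hl
    split_ifs at hl with hc
    · rw [PMF.mem_support_bind_iff] at hl
      obtain ⟨e, he, hl⟩ := hl
      rw [PMF.mem_support_map_iff] at hl
      obtain ⟨l', hl', rfl⟩ := hl
      have he' : G.tail e = v := by simpa [outEdges] using he
      refine ⟨he', ih _ ?_ (hout e) l' hl'⟩
      have := hlt e
      rw [he'] at this
      omega
    · have : l = [] := by simpa using hl
      subst this
      by_contra hne
      obtain ⟨e, he⟩ := hs hne
      exact hc ⟨hne, e, by simp [outEdges, he]⟩

/-- In every network of the `b`-ary model, the random path ends at the sink. -/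
theorem isWalk_of_mem_support_randomPath {b n : ℕ} (hn : 1 ≤ n) {G : Network n}
    (hG : G ∈ (random b n).support) {l : List (Fin n)} (hl : l ∈ G.randomPath.support) :
    G.IsWalk source l sink := by
  obtain ⟨⟨h, hlt, hle⟩, -, -, hs, hout⟩ := good_of_mem_support hn hG
  exact isWalk_of_height G h hlt hout n source (hle _) (fun _ => hs) l hl

end Network

/-- The expectation of the length of a random source-to-sink path in a random network of size `n`
in the `b`-ary model. -/
noncomputable def expectedPathLength (b n : ℕ) : ℝ :=
  ∫ m, (m : ℝ) ∂(Network.pathLengthLaw b n).toMeasure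

/-- The polynomial `λ (λ + 1) ⋯ (λ + b - 1) - (b - 1)!`. -/
noncomputable def charPoly (b : ℕ) : Polynomial ℂ :=
  ascPochhammer ℂ b - Polynomial.C ((b - 1).factorial : ℂ)

/-- The difference `H_{x+m} - H_x = ∑_{k=1}^m 1 / (x + k)` of harmonic numbers. -/
def harmonicDiff {K : Type*} [Field K] (x : K) (m : ℕ) : K :=
  ∑ k ∈ Finset.Icc 1 m, 1 / (x + k)

/-! Give each out-degree `d` a weight `u d`, and sum the weights of the nodes other than the sink
that the random walk visits. Growing at an edge out of a node of out-degree `d < b` raises that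
degree to `d + 1`; at out-degree `b` it puts a new node of out-degree `1` on the chosen edge. If `d
(u (d+1) - u d) = λ u d` for `1 ≤ d < b` and `u 1 = λ u b`, these effects combine so that one step
from size `n` multiplies the conditional expectation by exactly `1 + λ/n` (`sum_value_grow`). The
recursion is solved by `eigenWeight`, and its closing condition is the characteristic equation.
Hence each root `λ` yields a mean `∏ (1 + λ/k)`, which is a binomial coefficient
(`mean_pathSum_eigen`, `choose_eq_prod`).

The path length itself has weight `1`. Lagrange interpolation at the roots, evaluated at `0`, writes
this constant as a combination of the eigenweights, with the coefficients of the theorem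
(`sum_eigenWeight`). This needs simple roots: a multiple root would satisfy `∑ 1/(z+k) = 0`, hence
be real and strictly between `-(b-1)` and `0`, where the rising factorial is smaller than `(b-1)!`
in absolute value.

For the asymptotics, the product for `z` divided by `n^z` tends to `1/Γ(z+1)` by Euler's limit, and
the positive root has strictly the largest real part (`re_lt_of_isRoot`). -/

namespace Network

/-! ### Weighted path lengths and their Bellman equation -/

section PathSum

variable {K : Type*} [Semifield K] {n : ℕ}

/-- The expected value of the sum of the weights `u (outDegree w)` over all nodes `w`, other than
the sink, visited in the first `k` steps of the random walk from `v`. -/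
def pathSum (G : Network n) (u : ℕ → K) : ℕ → ℕ → K
  | 0, _ => 0
  | k + 1, v =>
      if v ≠ sink ∧ G.outDegree v ≠ 0 then
        u (G.outDegree v) + (∑ e ∈ G.outEdges v, pathSum G u k (G.head e)) / G.outDegree v
      else 0

/-- The Bellman equation of the weighted path length. -/
def IsPathValue (G : Network n) (u : ℕ → K) (V : ℕ → K) : Prop :=
  ∀ v, V v = if v ≠ sink ∧ G.outDegree v ≠ 0 then
    u (G.outDegree v) + (∑ e ∈ G.outEdges v, V (G.head e)) / G.outDegree v else 0

theorem tail_of_mem_outEdges {G : Network n} {v : ℕ} {e : Fin n} (he : e ∈ G.outEdges v) :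
    G.tail e = v := by simpa [outEdges] using he

theorem outDegree_pos_of_tail (G : Network n) (e : Fin n) : G.outDegree (G.tail e) ≠ 0 := by
  unfold outDegree
  exact Finset.card_ne_zero_of_mem (a := e) (by simp [outEdges])

/-- Heights drop along edges, so a walk from `v` has at most `h v` steps and any longer horizon is
irrelevant. This is what makes the truncated sum solve the Bellman equation. -/
theorem pathSum_eq_of_height_le (G : Network n) (u : ℕ → K) (h : ℕ → ℕ)
    (hlt : ∀ e, h (G.head e) < h (G.tail e)) :
    ∀ k l v, h v ≤ k → h v ≤ l → pathSum G u k v = pathSum G u l v := by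
  have hzero : ∀ v, h v = 0 → G.outDegree v = 0 := by
    intro v hv
    by_contra hne
    obtain ⟨e, he⟩ := Finset.card_ne_zero.mp hne
    have := hlt e
    rw [tail_of_mem_outEdges he] at this
    omega
  intro k
  induction k with
  | zero =>
    intro l v hk _
    have := hzero v (by omega)
    cases l <;> simp [pathSum, this]
  | succ k ih =>
    intro l v hk hl
    cases l with
    | zero =>
      have := hzero v (by omega)
      simp [pathSum, this]
    | succ l =>
      rw [pathSum, pathSum]
      congr 3
      refine Finset.sum_congr rfl fun e he => ?_
      have := hlt e
      rw [tail_of_mem_outEdges he] at this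
      exact ih l _ (by omega) (by omega)

theorem isPathValue_pathSum (G : Network n) (u : ℕ → K) (h : ℕ → ℕ)
    (hlt : ∀ e, h (G.head e) < h (G.tail e)) (hle : ∀ v, h v ≤ n) :
    IsPathValue G u (pathSum G u n) := by
  intro v
  rw [pathSum_eq_of_height_le G u h hlt n (n + 1) v (hle v) ((hle v).trans (Nat.le_succ n)),
    pathSum]

theorem pathSum_linearCombination {ι : Type*} (s : Finset ι) (G : Network n) (c : ι → K)
    (u : ι → ℕ → K) (r : ℕ → K) (b : ℕ) (hb : ∀ v, G.outDegree v ≤ b)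
    (hr : ∀ d, d ≠ 0 → d ≤ b → r d = ∑ i ∈ s, c i * u i d) (k : ℕ) :
    ∀ v, pathSum G r k v = ∑ i ∈ s, c i * pathSum G (u i) k v := by
  induction k with
  | zero => simp [pathSum]
  | succ k ih =>
    intro v
    simp only [pathSum]
    split_ifs with hc
    · rw [hr _ hc.2 (hb v)]
      simp only [mul_add, Finset.sum_add_distrib, ih, div_eq_mul_inv, Finset.sum_mul,
        Finset.mul_sum]
      congr 1
      rw [Finset.sum_comm]
      simp only [mul_assoc]
    · simp

end PathSum

/-! ### Out-degrees and out-edges after one growth step -/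

section Grow

variable {n : ℕ}

theorem outDegree_eq_sum (G : Network n) (v : ℕ) :
    G.outDegree v = ∑ e, if G.tail e = v then 1 else 0 := by
  simp [outDegree, outEdges]

theorem sum_outEdges {M : Type*} [AddCommMonoid M] (G : Network n) (v : ℕ) (f : Fin n → M) :
    ∑ e ∈ G.outEdges v, f e = ∑ e, if G.tail e = v then f e else 0 :=
  Finset.sum_filter _ _

theorem outDegree_parallel (G : Network n) (j : Fin n) (v : ℕ) :
    (G.parallel j).outDegree v = G.outDegree v + if G.tail j = v then 1 else 0 := by
  simp only [outDegree_eq_sum, Fin.sum_univ_castSucc, parallel, Fin.snoc_castSucc, Fin.snoc_last]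

theorem sum_head_parallel {M : Type*} [AddCommMonoid M] (G : Network n) (j : Fin n) (v : ℕ)
    (V : ℕ → M) :
    ∑ e ∈ (G.parallel j).outEdges v, V ((G.parallel j).head e) =
      ∑ e ∈ G.outEdges v, V (G.head e) + if G.tail j = v then V (G.head j) else 0 := by
  simp only [sum_outEdges, Fin.sum_univ_castSucc, parallel, Fin.snoc_castSucc, Fin.snoc_last]

theorem outDegree_serial (G : Network n) (j : Fin n) (v : ℕ) :
    (G.serial j).outDegree v = G.outDegree v + if n + 1 = v then 1 else 0 := by
  simp only [outDegree_eq_sum, Fin.sum_univ_castSucc, serial, Fin.snoc_castSucc, Fin.snoc_last]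

theorem sum_head_serial {M : Type*} [AddCommMonoid M] (G : Network n) (j : Fin n) (v : ℕ)
    (V : ℕ → M) :
    ∑ e ∈ (G.serial j).outEdges v, V ((G.serial j).head e) =
      ∑ e ∈ G.outEdges v, V (if e = j then n + 1 else G.head e) +
        if n + 1 = v then V (G.head j) else 0 := by
  simp only [sum_outEdges, Fin.sum_univ_castSucc, serial, Fin.snoc_castSucc, Fin.snoc_last]

theorem outDegree_eq_zero_of_lt {G : Network n} (ht : ∀ e, G.tail e ≤ n) :
    G.outDegree (n + 1) = 0 := by
  rw [outDegree_eq_sum]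
  refine Finset.sum_eq_zero fun e _ => if_neg ?_
  have := ht e
  omega

theorem outDegree_grow_le {b : ℕ} (hb : 1 ≤ b) {G : Network n} (ht : ∀ e, G.tail e ≤ n)
    (hG : ∀ v, G.outDegree v ≤ b) (j : Fin n) (v : ℕ) : (G.grow b j).outDegree v ≤ b := by
  unfold grow
  split_ifs with hlt
  · rw [outDegree_parallel]
    split_ifs with h
    · rwa [← h]
    · exact hG v
  · rw [outDegree_serial]
    split_ifs with h
    · rw [← h, outDegree_eq_zero_of_lt ht]
      exact hb
    · exact hG v

/-- Away from the modified edge's start, growing does not change what the random walk sees. -/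
theorem grow_local {M : Type*} [AddCommMonoid M] (b : ℕ) (G : Network n) (j : Fin n) {v : ℕ}
    (hv : v ≠ n + 1) (hj : G.tail j ≠ v) (V : ℕ → M) :
    (G.grow b j).outDegree v = G.outDegree v ∧
      ∑ e ∈ (G.grow b j).outEdges v, V ((G.grow b j).head e) =
        ∑ e ∈ G.outEdges v, V (G.head e) := by
  unfold grow
  split_ifs with hlt
  · simp [outDegree_parallel, sum_head_parallel, hj]
  · rw [outDegree_serial, sum_head_serial, if_neg (Ne.symm hv), if_neg (Ne.symm hv), add_zero,
      add_zero]
    refine ⟨rfl, Finset.sum_congr rfl fun e he => ?_⟩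
    rw [if_neg]
    rintro rfl
    exact hj (tail_of_mem_outEdges he)

end Grow

/-! ### The eigenvalue identity for one growth step -/

section OneStep

variable {K : Type*} [Field K] {n : ℕ}

/-- Growing at an edge `j` changes the values only at nodes that are not strictly lower than the
start of `j`. -/
theorem value_grow_eq_of_lower {b : ℕ} {G : Network n} {u V W : ℕ → K} {h : ℕ → ℕ}
    (hlt : ∀ e, h (G.head e) < h (G.tail e)) (hh : ∀ e, G.head e ≤ n)
    (hV : IsPathValue G u V) (j : Fin n) (hW : IsPathValue (G.grow b j) u W) :
    ∀ m v, h v = m → v ≠ n + 1 → m < h (G.tail j) → W v = V v := by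
  intro m
  induction m using Nat.strong_induction_on with
  | _ m ih =>
    intro v hm hv hlow
    have hj : G.tail j ≠ v := by rintro rfl; omega
    obtain ⟨h1, h2⟩ := grow_local b G j hv hj W
    rw [hW v, hV v, h1, h2]
    congr 3
    refine Finset.sum_congr rfl fun e he => ?_
    have h3 := hlt e
    have h4 := hh e
    rw [tail_of_mem_outEdges he] at h3
    exact ih _ (by omega) _ rfl (by omega) (by omega)

theorem value_head_grow_eq {b : ℕ} {G : Network n} {u V W : ℕ → K} {h : ℕ → ℕ}
    (hlt : ∀ e, h (G.head e) < h (G.tail e)) (hh : ∀ e, G.head e ≤ n)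
    (hV : IsPathValue G u V) {j : Fin n} (hW : IsPathValue (G.grow b j) u W) {v : ℕ}
    (hj : j ∈ G.outEdges v) {e : Fin n} (he : e ∈ G.outEdges v) :
    W (G.head e) = V (G.head e) := by
  have h3 := hlt e
  have h4 := hh e
  rw [tail_of_mem_outEdges he, ← tail_of_mem_outEdges hj] at h3
  exact value_grow_eq_of_lower hlt hh hV j hW _ _ rfl (by omega) h3

variable [CharZero K]

/-- The total effect on the value at `v` of growing at the edges that start at `v`. -/
theorem sum_value_grow_outEdges {b : ℕ} {G : Network n} {lam : K} {u V : ℕ → K} {h : ℕ → ℕ}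
    (hn : 1 ≤ n)
    (hlt : ∀ e, h (G.head e) < h (G.tail e)) (hh : ∀ e, G.head e ≤ n) (ht : ∀ e, G.tail e ≤ n)
    (hdeg : ∀ v, G.outDegree v ≤ b)
    (hu : ∀ d : ℕ, d ≠ 0 → d < b → (d : K) * (u (d + 1) - u d) = lam * u d)
    (hub : u 1 = lam * u b)
    (hV : IsPathValue G u V) (W : Fin n → ℕ → K)
    (hW : ∀ j, IsPathValue (G.grow b j) u (W j)) {v : ℕ} (hv : v ≠ n + 1) (hs : v ≠ sink)
    (hd : G.outDegree v ≠ 0) :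
    ∑ j ∈ G.outEdges v, W j v = G.outDegree v * V v + lam * u (G.outDegree v) := by
  have hd' : (G.outDegree v : K) ≠ 0 := Nat.cast_ne_zero.mpr hd
  have hd1 : (G.outDegree v : K) + 1 ≠ 0 := Nat.cast_add_one_ne_zero _
  have hlow : ∀ j ∈ G.outEdges v, ∀ e ∈ G.outEdges v, W j (G.head e) = V (G.head e) :=
    fun j hj e he => value_head_grow_eq hlt hh hV (hW j) hj he
  set S := ∑ e ∈ G.outEdges v, V (G.head e) with hS
  have hVv : V v = u (G.outDegree v) + S / G.outDegree v := by
    rw [hV v, if_pos ⟨hs, hd⟩]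
  by_cases hb : G.outDegree v < b
  -- Parallel case, with `d` the out-degree: summing over the `d` choices of `j` gives `d u(d+1) +
  -- (d S + S)/(d+1) = d u(d+1) + S`, so doubling leaves the average over the heads unchanged.
  · have key : ∀ j ∈ G.outEdges v, W j v = u (G.outDegree v + 1) +
        (S + V (G.head j)) / (G.outDegree v + 1) := by
      intro j hj
      have hjv := tail_of_mem_outEdges hj
      have hg : G.grow b j = G.parallel j := by rw [grow, hjv, if_pos hb]
      have hWj := hW j v
      rw [hg, outDegree_parallel, sum_head_parallel, if_pos hjv, if_pos hjv,
        if_pos ⟨hs, Nat.succ_ne_zero _⟩, hlow j hj j hj,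
        Finset.sum_congr rfl (hlow j hj)] at hWj
      rw [hWj]
      push_cast
      rfl
    rw [Finset.sum_congr rfl key, Finset.sum_add_distrib, ← Finset.sum_div,
      Finset.sum_add_distrib, ← hS, Finset.sum_const, Finset.sum_const, ← hu _ hd hb, hVv]
    change G.outDegree v • _ + (G.outDegree v • _ + _) / _ = _
    simp only [nsmul_eq_mul]
    field_simp
    ring
  · have hbv : G.outDegree v = b := le_antisymm (hdeg v) (not_lt.mp hb)
    have key : ∀ j ∈ G.outEdges v, W j v = u (G.outDegree v) + (S + u 1) / G.outDegree v := by
      intro j hj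
      have hjv := tail_of_mem_outEdges hj
      have hg : G.grow b j = G.serial j := by rw [grow, hjv, if_neg hb]
      have hnew : W j (n + 1) = u 1 + V (G.head j) := by
        have hWj := hW j (n + 1)
        have h0 := outDegree_eq_zero_of_lt ht
        have h0' : G.outEdges (n + 1) = ∅ := Finset.card_eq_zero.mp h0
        -- The new node `n + 1` differs from the sink `1` because `1 ≤ n`.
        rw [hg, outDegree_serial, sum_head_serial, if_pos rfl, if_pos rfl, h0, h0',
          if_pos ⟨by simp only [sink]; omega, by norm_num⟩, hlow j hj j hj] at hWj
        simpa using hWj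
      have hWj := hW j v
      rw [hg, outDegree_serial, sum_head_serial, if_neg (Ne.symm hv), if_neg (Ne.symm hv),
        add_zero, add_zero, if_pos ⟨hs, hd⟩] at hWj
      rw [hWj]
      congr 2
      have : ∀ e ∈ G.outEdges v, W j (if e = j then n + 1 else G.head e) =
          V (G.head e) + if e = j then u 1 else 0 := by
        intro e he
        split_ifs with hej
        · rw [hnew, hej, add_comm]
        · rw [hlow j hj e he, add_zero]
      rw [Finset.sum_congr rfl this, Finset.sum_add_distrib, Finset.sum_ite_eq' _ j, if_pos hj]
    rw [Finset.sum_congr rfl key, Finset.sum_const, hVv]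
    change G.outDegree v • _ = _
    rw [hbv] at hd' ⊢
    rw [nsmul_eq_mul, hub]
    field_simp
    ring

/-- If `u` is a left eigenvector for the eigenvalue `lam` of the out-degree dynamics, then one
growth step multiplies the expected weighted path length by `1 + lam / n`. -/
theorem sum_value_grow {b : ℕ} {G : Network n} {lam : K} {u V : ℕ → K} {h : ℕ → ℕ}
    (hn : 1 ≤ n)
    (hlt : ∀ e, h (G.head e) < h (G.tail e)) (hh : ∀ e, G.head e ≤ n) (ht : ∀ e, G.tail e ≤ n)
    (hdeg : ∀ v, G.outDegree v ≤ b)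
    (hu : ∀ d : ℕ, d ≠ 0 → d < b → (d : K) * (u (d + 1) - u d) = lam * u d)
    (hub : u 1 = lam * u b)
    (hV : IsPathValue G u V) (W : Fin n → ℕ → K)
    (hW : ∀ j, IsPathValue (G.grow b j) u (W j)) :
    ∀ m v, h v = m → v ≠ n + 1 → ∑ j, W j v = (n + lam) * V v := by
  intro m
  induction m using Nat.strong_induction_on with
  | _ m ih =>
    intro v hm hv
    by_cases hc : v ≠ sink ∧ G.outDegree v ≠ 0
    · obtain ⟨hs, hd⟩ := hc
      have hd' : (G.outDegree v : K) ≠ 0 := Nat.cast_ne_zero.mpr hd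
      have hlow : ∀ j ∈ G.outEdges v, ∀ e ∈ G.outEdges v, W j (G.head e) = V (G.head e) :=
        fun j hj e he => value_head_grow_eq hlt hh hV (hW j) hj he
      have hVv : V v = u (G.outDegree v) + (∑ e ∈ G.outEdges v, V (G.head e)) / G.outDegree v := by
        rw [hV v, if_pos ⟨hs, hd⟩]
      -- `R j` uses the old out-edges of `v` with the new values at their heads. It equals `W j v`
      -- unless `j` starts at `v`, and equals `V v` if it does; so `∑ W j v` is `∑ R j`, known by
      -- induction on the height, plus the local correction `lam * u d`.
      let R : Fin n → K := fun j =>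
        u (G.outDegree v) + (∑ e ∈ G.outEdges v, W j (G.head e)) / G.outDegree v
      have hdiff : ∑ j, (W j v - R j) = ∑ j ∈ G.outEdges v, (W j v - R j) := by
        symm
        refine Finset.sum_subset (Finset.subset_univ _) fun j _ hj => ?_
        have hj' : G.tail j ≠ v := by simpa [outEdges] using hj
        obtain ⟨h1, h2⟩ := grow_local b G j hv hj' (W j)
        rw [hW j v, h1, h2, if_pos ⟨hs, hd⟩, sub_self]
      have hRv : ∀ j ∈ G.outEdges v, R j = V v := by
        intro j hj
        simp only [R]
        rw [Finset.sum_congr rfl (hlow j hj), hVv]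
      have hRsum : ∑ j, R j = n * u (G.outDegree v) +
          (n + lam) * (∑ e ∈ G.outEdges v, V (G.head e)) / G.outDegree v := by
        simp only [R]
        rw [Finset.sum_add_distrib, ← Finset.sum_div, Finset.sum_comm, Finset.mul_sum]
        congr 1
        · simp
        · congr 1
          refine Finset.sum_congr rfl fun e he => ?_
          have h3 := hlt e
          have h4 := hh e
          rw [tail_of_mem_outEdges he] at h3
          exact ih _ (by omega) _ rfl (by omega)
      rw [Finset.sum_sub_distrib, Finset.sum_sub_distrib, Finset.sum_congr rfl hRv,
        Finset.sum_const, sum_value_grow_outEdges hn hlt hh ht hdeg hu hub hV W hW hv hs hd,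
        hRsum] at hdiff
      change _ = _ - G.outDegree v • _ at hdiff
      rw [nsmul_eq_mul] at hdiff
      rw [eq_add_of_sub_eq hdiff, hVv]
      field_simp
      ring
    · have hV0 : V v = 0 := by rw [hV v, if_neg hc]
      rw [hV0, mul_zero]
      refine Finset.sum_eq_zero fun j _ => ?_
      by_cases hs : v = sink
      · rw [hW j v, if_neg (fun h => h.1 hs)]
      · have hd : G.outDegree v = 0 := by
          by_contra hne
          exact hc ⟨hs, hne⟩
        have hj : G.tail j ≠ v := by
          rintro rfl
          exact outDegree_pos_of_tail G j hd
        rw [hW j v, (grow_local b G j hv hj (W j)).1, if_neg (fun h => h.2 hd)]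

end OneStep

end Network

/-! ### Averages over the random network as finite sums -/

namespace Network

/-- The expectation of `f` under the law of the random network of size `n`, as a finite sum. -/
def mean {K : Type*} [Semifield K] (b : ℕ) : (n : ℕ) → (Network n → K) → K
  | 0, f => f ⟨Fin.elim0, Fin.elim0⟩
  | 1, f => f single
  | n + 2, f => mean b (n + 1) fun G => (∑ j, f (G.grow b j)) / ((n + 1 : ℕ) : K)

section Mean

variable {K : Type*} [Semifield K] {b : ℕ}

theorem good_single : single.Good :=
  ⟨⟨fun v => 1 - v, by simp [single], by simp⟩, by simp [single], by simp [single],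
    by simp [single], by simp [single]⟩

/-- Acyclicity and the bound `b` on out-degrees are preserved by growth, so identities needing them
may be used under the mean. -/
theorem mean_congr (hb : 1 ≤ b) : ∀ n (f g : Network (n + 1) → K),
    (∀ G : Network (n + 1), G.Good → (∀ v, G.outDegree v ≤ b) → f G = g G) →
      mean b (n + 1) f = mean b (n + 1) g := by
  intro n
  induction n with
  | zero =>
    intro f g hfg
    refine hfg _ good_single fun v => le_trans ?_ hb
    exact (Finset.card_filter_le _ _).trans (by simp)
  | succ n ih =>
    intro f g hfg
    refine ih _ _ fun G hG hd => ?_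
    congr 1
    exact Finset.sum_congr rfl fun j _ =>
      hfg _ (good_grow G hG j) (outDegree_grow_le hb hG.2.1 hd j)

theorem mean_const_mul : ∀ n (c : K) (f : Network (n + 1) → K),
    mean b (n + 1) (fun G => c * f G) = c * mean b (n + 1) f := by
  intro n
  induction n with
  | zero => intro c f; rfl
  | succ n ih =>
    intro c f
    simp only [mean, ← Finset.mul_sum, mul_div_assoc]
    exact ih c _

theorem mean_sum {ι : Type*} (s : Finset ι) : ∀ n (f : ι → Network (n + 1) → K),
    mean b (n + 1) (fun G => ∑ i ∈ s, f i G) = ∑ i ∈ s, mean b (n + 1) (f i) := by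
  intro n
  induction n with
  | zero => intro f; rfl
  | succ n ih =>
    intro f
    simp only [mean]
    rw [← ih]
    congr 1
    funext G
    rw [Finset.sum_comm, Finset.sum_div]

end Mean

theorem map_mean {K L : Type*} [Semifield K] [Semifield L] (φ : K →+* L) (b : ℕ) :
    ∀ n (f : Network (n + 1) → K), φ (mean b (n + 1) f) = mean b (n + 1) fun G => φ (f G) := by
  intro n
  induction n with
  | zero => intro f; rfl
  | succ n ih =>
    intro f
    simp only [mean]
    rw [ih]
    simp only [map_div₀, map_sum, map_natCast]

theorem map_pathSum {K L : Type*} [Semifield K] [Semifield L] (φ : K →+* L) {n : ℕ}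
    (G : Network n) (u : ℕ → K) (k : ℕ) :
    ∀ v, φ (pathSum G u k v) = pathSum G (fun d => φ (u d)) k v := by
  induction k with
  | zero => simp [pathSum]
  | succ k ih =>
    intro v
    simp only [pathSum]
    split_ifs <;> simp [ih, map_sum]

section Eigen

variable {K : Type*} [Field K] [CharZero K]

/-- The expected weighted path length for an eigenvector of the out-degree dynamics. -/
theorem mean_pathSum_eigen {b : ℕ} (hb : 1 ≤ b) {lam : K} {u : ℕ → K}
    (hu : ∀ d : ℕ, d ≠ 0 → d < b → (d : K) * (u (d + 1) - u d) = lam * u d)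
    (hub : u 1 = lam * u b) (n : ℕ) :
    mean b (n + 1) (fun G => pathSum G u (n + 1) source) =
      u 1 * ∏ k ∈ Finset.range n, (1 + lam / ((k + 1 : ℕ) : K)) := by
  induction n with
  | zero =>
    have h1 : single.outDegree 0 = 1 := by simp [outDegree_eq_sum, single]
    simp [mean, pathSum, h1]
  | succ n ih =>
    rw [Finset.prod_range_succ, ← mul_assoc, ← ih, mul_comm, ← mean_const_mul, mean]
    refine mean_congr hb _ _ _ fun G hG hd => ?_
    obtain ⟨⟨h, hlt, hle⟩, ht, hh, -, -⟩ := id hG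
    have hW : ∀ j, IsPathValue (G.grow b j) u (pathSum (G.grow b j) u (n + 1 + 1)) := by
      intro j
      obtain ⟨⟨h', hlt', hle'⟩, -⟩ := good_grow (b := b) G hG j
      exact isPathValue_pathSum _ _ h' hlt' hle'
    rw [sum_value_grow (by omega) hlt hh ht hd hu hub (isPathValue_pathSum G u h hlt hle) _ hW
      _ _ rfl (by simp [source])]
    have : ((n + 1 : ℕ) : K) ≠ 0 := Nat.cast_ne_zero.mpr (Nat.succ_ne_zero n)
    field_simp

end Eigen

end Network

/-! ### From probability laws to finite sums -/

section PMF

open scoped NNReal ENNReal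

variable {α β : Type*}

theorem PMF.tsum_bind_mul (p : PMF α) (q : α → PMF β) (f : β → ℝ≥0∞) :
    ∑' y, p.bind q y * f y = ∑' x, p x * ∑' y, q x y * f y := by
  simp only [PMF.bind_apply, ← ENNReal.tsum_mul_right, ← ENNReal.tsum_mul_left]
  rw [ENNReal.tsum_comm]
  simp only [mul_assoc]

theorem PMF.tsum_pure_mul (a : α) (f : α → ℝ≥0∞) : ∑' y, PMF.pure a y * f y = f a := by
  classical
  rw [tsum_eq_single a]
  · simp
  · intro y hy
    simp [PMF.pure_apply, hy]

theorem PMF.tsum_map_mul (p : PMF α) (g : α → β) (f : β → ℝ≥0∞) :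
    ∑' y, p.map g y * f y = ∑' x, p x * f (g x) := by
  rw [PMF.map, PMF.tsum_bind_mul]
  simp only [Function.comp_apply, PMF.tsum_pure_mul]

theorem PMF.tsum_uniformOfFinset_mul (s : Finset α) (hs : s.Nonempty) (f : α → ℝ≥0) :
    ∑' x, PMF.uniformOfFinset s hs x * (f x : ℝ≥0∞) = ((∑ x ∈ s, f x) / s.card : ℝ≥0) := by
  classical
  rw [tsum_eq_sum (s := s)]
  · rw [Finset.sum_congr rfl fun x hx => by rw [PMF.uniformOfFinset_apply_of_mem hs hx],
      ← Finset.mul_sum, ENNReal.coe_div (by simpa using hs.ne_empty), ENNReal.div_eq_inv_mul]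
    simp
  · intro x hx
    rw [PMF.uniformOfFinset_apply_of_notMem hs hx, zero_mul]

end PMF

namespace Network

open scoped NNReal ENNReal

theorem tsum_random_mul (b : ℕ) : ∀ n (f : Network (n + 1) → ℝ≥0),
    ∑' G, random b (n + 1) G * (f G : ℝ≥0∞) = (mean b (n + 1) f : ℝ≥0) := by
  intro n
  induction n with
  | zero =>
    intro f
    rw [random, PMF.tsum_pure_mul]
    rfl
  | succ n ih =>
    intro f
    rw [random, PMF.tsum_bind_mul, mean, ← ih]
    refine tsum_congr fun G => ?_
    congr 1
    rw [PMF.tsum_map_mul, PMF.uniformOfFintype, PMF.tsum_uniformOfFinset_mul]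
    simp

/-- Each visited node from which a step is taken contributes one edge, so the length is the path sum
with weight `1`. Working in `ℝ≥0` avoids summability questions. -/
theorem tsum_randomWalk_length {n : ℕ} (G : Network n) (k : ℕ) : ∀ v,
    ∑' l, G.randomWalk k v l * ((l.length : ℝ≥0) : ℝ≥0∞) =
      (pathSum G (fun _ => (1 : ℝ≥0)) k v : ℝ≥0) := by
  induction k with
  | zero =>
    intro v
    rw [randomWalk, PMF.tsum_pure_mul]
    simp [pathSum]
  | succ k ih =>
    intro v
    have hiff : (v ≠ sink ∧ (G.outEdges v).Nonempty) ↔ (v ≠ sink ∧ G.outDegree v ≠ 0) := by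
      rw [outDegree, Finset.card_ne_zero]
    rw [randomWalk, pathSum]
    by_cases hc : v ≠ sink ∧ (G.outEdges v).Nonempty
    · rw [dif_pos hc, if_pos (hiff.mp hc), PMF.tsum_bind_mul]
      have hstep : ∀ e, ∑' l, ((G.randomWalk k (G.head e)).map fun l => e :: l) l *
          ((l.length : ℝ≥0) : ℝ≥0∞) =
          ((1 + pathSum G (fun _ => (1 : ℝ≥0)) k (G.head e) : ℝ≥0) : ℝ≥0∞) := by
        intro e
        rw [PMF.tsum_map_mul, ENNReal.coe_add, ← ih, add_comm]
        simp only [List.length_cons, Nat.cast_add, Nat.cast_one, ENNReal.coe_add, mul_add,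
          ENNReal.coe_one, mul_one, ENNReal.tsum_add, PMF.tsum_coe]
      simp only [hstep]
      rw [PMF.tsum_uniformOfFinset_mul, Finset.sum_add_distrib, add_div]
      have h0 : ((G.outEdges v).card : ℝ≥0) ≠ 0 := by simpa using hc.2.ne_empty
      rw [Finset.sum_const, nsmul_eq_mul, mul_one, div_self h0]
      rfl
    · rw [dif_neg hc, if_neg (hiff.not.mp hc), PMF.tsum_pure_mul]
      simp

theorem lintegral_pathLengthLaw (b n : ℕ) :
    ∫⁻ m, ((m : ℝ≥0) : ℝ≥0∞) ∂(pathLengthLaw b (n + 1)).toMeasure =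
      (mean b (n + 1) (fun G => pathSum G (fun _ => (1 : ℝ≥0)) (n + 1) source) : ℝ≥0) := by
  rw [MeasureTheory.lintegral_countable', ← tsum_random_mul]
  simp only [PMF.toMeasure_apply_singleton _ _ (MeasurableSet.singleton _)]
  simp only [mul_comm (ENNReal.ofNNReal _)]
  rw [pathLengthLaw, PMF.tsum_bind_mul]
  simp only [PMF.tsum_map_mul, randomPath, tsum_randomWalk_length]

end Network

theorem integrable_pathLengthLaw (b n : ℕ) :
    MeasureTheory.Integrable (fun m : ℕ => (m : ℝ))
      (Network.pathLengthLaw b (n + 1)).toMeasure := by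
  refine ⟨(measurable_of_countable _).aestronglyMeasurable, ?_⟩
  rw [MeasureTheory.hasFiniteIntegral_iff_enorm]
  have : ∀ m : ℕ, ‖(m : ℝ)‖ₑ = ((m : NNReal) : ENNReal) := by intro m; simp
  simp only [this, Network.lintegral_pathLengthLaw]
  exact ENNReal.coe_lt_top

/-- The mean and the path sum use only semifield operations, so they commute with the ring
homomorphism from `ℝ≥0` to `ℂ`, where the eigenvalues live. -/
theorem expectedPathLength_eq_mean (b n : ℕ) :
    (expectedPathLength b (n + 1) : ℂ) = Network.mean b (n + 1)
      (fun G => Network.pathSum G (fun _ => (1 : ℂ)) (n + 1) Network.source) := by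
  have h1 : expectedPathLength b (n + 1) = ((Network.mean b (n + 1) (fun G =>
      Network.pathSum G (fun _ => (1 : NNReal)) (n + 1) Network.source) : NNReal) : ℝ) := by
    rw [expectedPathLength, MeasureTheory.integral_eq_lintegral_of_nonneg_ae
      (Filter.Eventually.of_forall fun m => Nat.cast_nonneg m)
      (measurable_of_countable _).aestronglyMeasurable]
    have : ∀ m : ℕ, ENNReal.ofReal (m : ℝ) = ((m : NNReal) : ENNReal) := by intro m; simp
    simp only [this, Network.lintegral_pathLengthLaw, ENNReal.coe_toReal]
  have h2 := Network.map_mean (Complex.ofRealHom.comp NNReal.toRealHom) b n (fun G =>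
      Network.pathSum G (fun _ => (1 : NNReal)) (n + 1) Network.source)
  rw [h1]
  refine h2.trans ?_
  congr 1
  funext G
  rw [Network.map_pathSum]
  simp

/-! ### Simplicity of the roots and partial fractions -/

section CharPoly

open Polynomial

theorem ascPochhammer_eval_eq_prod {R : Type*} [CommSemiring R] (n : ℕ) (x : R) :
    (ascPochhammer R n).eval x = ∏ k ∈ Finset.range n, (x + k) := by
  induction n with
  | zero => simp
  | succ n ih => rw [ascPochhammer_succ_eval, ih, Finset.prod_range_succ]

theorem eval_derivative_ascPochhammer {K : Type*} [Field K] (n : ℕ) (x : K)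
    (hx : ∀ k ∈ Finset.range n, x + (k : K) ≠ 0) :
    (derivative (ascPochhammer K n)).eval x =
      (ascPochhammer K n).eval x * ∑ k ∈ Finset.range n, 1 / (x + k) := by
  induction n with
  | zero => simp
  | succ n ih =>
    have h1 := ih fun k hk => hx k (Finset.mem_range.mpr (by have := Finset.mem_range.mp hk; omega))
    have h2 := hx n (Finset.self_mem_range_succ n)
    rw [ascPochhammer_succ_right, derivative_mul, Finset.sum_range_succ]
    simp only [eval_add, eval_mul, h1, derivative_add, derivative_X, derivative_natCast, eval_X,
      eval_natCast, add_zero, mul_one]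
    field_simp

theorem eval_charPoly (b : ℕ) (z : ℂ) :
    (charPoly b).eval z = ∏ k ∈ Finset.range b, (z + k) - ((b - 1).factorial : ℂ) := by
  rw [charPoly, eval_sub, eval_C, ascPochhammer_eval_eq_prod]

theorem isRoot_charPoly_iff {b : ℕ} {z : ℂ} :
    (charPoly b).IsRoot z ↔ ∏ k ∈ Finset.range b, (z + k) = ((b - 1).factorial : ℂ) := by
  rw [IsRoot.def, eval_charPoly, sub_eq_zero]

theorem add_natCast_ne_zero_of_isRoot {b : ℕ} {z : ℂ} (hz : (charPoly b).IsRoot z) :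
    ∀ k ∈ Finset.range b, z + (k : ℂ) ≠ 0 := by
  rw [← Finset.prod_ne_zero_iff, isRoot_charPoly_iff.mp hz]
  exact_mod_cast (b - 1).factorial_ne_zero

theorem degree_C_lt_degree_ascPochhammer {b : ℕ} (hb : 1 ≤ b) (c : ℂ) :
    (C c).degree < (ascPochhammer ℂ b).degree := by
  refine degree_C_le.trans_lt ?_
  rw [← natDegree_pos_iff_degree_pos, ascPochhammer_natDegree]
  exact hb

theorem monic_charPoly {b : ℕ} (hb : 1 ≤ b) : (charPoly b).Monic :=
  (monic_ascPochhammer ℂ b).sub_of_left (degree_C_lt_degree_ascPochhammer hb _)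

theorem natDegree_charPoly (b : ℕ) : (charPoly b).natDegree = b := by
  rw [charPoly, natDegree_sub_C, ascPochhammer_natDegree]

theorem factorial_mul_factorial_le (c : ℕ) : ∀ a : ℕ,
    (a + 1).factorial * (c + 1).factorial ≤ (a + c + 1).factorial := by
  intro a
  induction a with
  | zero => simp
  | succ a ih =>
    calc (a + 1 + 1).factorial * (c + 1).factorial
        = (a + 2) * ((a + 1).factorial * (c + 1).factorial) := by
          rw [Nat.factorial_succ (a + 1)]; ring
      _ ≤ (a + c + 2) * (a + c + 1).factorial := Nat.mul_le_mul (by omega) ih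
      _ = (a + 1 + c + 1).factorial := by
          rw [show a + 1 + c + 1 = (a + c + 1) + 1 by ring, Nat.factorial_succ (a + c + 1)]

/-- Between its smallest and its largest root, the rising factorial is small. -/
theorem abs_prod_add_lt_factorial {b : ℕ} {x : ℝ} (h1 : -((b : ℝ) - 1) < x) (h0 : x < 0)
    (hx : ∀ k ∈ Finset.range b, x + (k : ℝ) ≠ 0) :
    |∏ k ∈ Finset.range b, (x + k)| < ((b - 1).factorial : ℝ) := by
  -- Split the product at the sign change. The first `a + 1` factors are bounded by `a + 1, …, 1`,
  -- strictly, and the remaining `c + 1` by `1, …, c + 1`.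
  set a := ⌊-x⌋₊ with ha
  have ha1 : (a : ℝ) ≤ -x := Nat.floor_le (by linarith)
  have ha2 : -x < a + 1 := Nat.lt_floor_add_one _
  have hab : a + 1 < b := by
    have : (a : ℝ) + 1 < b := by linarith
    exact_mod_cast this
  have ha3 : (a : ℝ) < -x := by
    refine lt_of_le_of_ne ha1 fun h => hx a (Finset.mem_range.mpr (by omega)) ?_
    rw [h]; ring
  obtain ⟨c, rfl⟩ : ∃ c, b = (a + 1) + (c + 1) := ⟨b - (a + 2), by omega⟩
  have hlow : ∏ k ∈ Finset.range (a + 1), |x + k| < ((a + 1).factorial : ℝ) := by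
    rw [← Finset.prod_range_add_one_eq_factorial, ← Finset.prod_range_reflect, Nat.cast_prod]
    refine Finset.prod_lt_prod_of_nonempty (fun k hk => abs_pos.mpr ?_) (fun k hk => ?_) (by simp)
    · exact hx _ (Finset.mem_range.mpr (by omega))
    · have hk' := Finset.mem_range.mp hk
      have hka : (k : ℝ) ≤ a := by exact_mod_cast Nat.lt_succ_iff.mp hk'
      rw [abs_lt, show a + 1 - 1 - k = a - k by omega, Nat.cast_add, Nat.cast_sub (by omega)]
      push_cast
      constructor <;> linarith
  have hhigh : ∏ k ∈ Finset.range (c + 1), |x + ((a + 1 + k : ℕ) : ℝ)| ≤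
      ((c + 1).factorial : ℝ) := by
    rw [← Finset.prod_range_add_one_eq_factorial, Nat.cast_prod]
    refine Finset.prod_le_prod (fun _ _ => abs_nonneg _) fun k _ => ?_
    have : (0 : ℝ) ≤ k := Nat.cast_nonneg k
    rw [abs_le]
    push_cast
    constructor <;> linarith
  rw [Finset.prod_range_add, abs_mul, Finset.abs_prod, Finset.abs_prod]
  calc _ ≤ _ * ((c + 1).factorial : ℝ) :=
        mul_le_mul_of_nonneg_left hhigh (Finset.prod_nonneg fun _ _ => abs_nonneg _)
    _ < ((a + 1).factorial : ℝ) * ((c + 1).factorial : ℝ) :=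
        mul_lt_mul_of_pos_right hlow (by exact_mod_cast Nat.factorial_pos _)
    _ ≤ _ := by
        rw [show a + 1 + (c + 1) - 1 = a + c + 1 by omega]
        exact_mod_cast factorial_mul_factorial_le c a

/-- At a root this sum is the derivative of `charPoly b` up to the factor `(b-1)!`, so this is the
simplicity of the roots. -/
theorem sum_inv_ne_zero_of_isRoot {b : ℕ} (hb : 1 ≤ b) {z : ℂ} (hz : (charPoly b).IsRoot z) :
    ∑ k ∈ Finset.range b, 1 / (z + (k : ℂ)) ≠ 0 := by
  intro hsum
  have hne := add_natCast_ne_zero_of_isRoot hz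
  have hnonempty : (Finset.range b).Nonempty := ⟨0, Finset.mem_range.mpr hb⟩
  -- The imaginary part of the sum is `-z.im * ∑ 1/|z+k|²`.
  have him : z.im = 0 := by
    have h := congrArg Complex.im hsum
    simp only [Complex.im_sum, one_div, Complex.inv_im, Complex.add_im, Complex.natCast_im,
      add_zero, Complex.zero_im] at h
    simp only [div_eq_mul_inv, ← Finset.mul_sum] at h
    refine neg_eq_zero.mp ((mul_eq_zero.mp h).resolve_right (ne_of_gt ?_))
    exact Finset.sum_pos (fun k hk => inv_pos.mpr (Complex.normSq_pos.mpr (hne k hk))) hnonempty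
  obtain ⟨x, rfl⟩ : ∃ x : ℝ, z = x := ⟨z.re, Complex.ext rfl (by simpa using him)⟩
  have hne' : ∀ k ∈ Finset.range b, x + (k : ℝ) ≠ 0 := fun k hk => by exact_mod_cast hne k hk
  have hsum' : ∑ k ∈ Finset.range b, 1 / (x + (k : ℝ)) = 0 := by exact_mod_cast hsum
  have hz' : ∏ k ∈ Finset.range b, (x + k) = ((b - 1).factorial : ℝ) := by
    exact_mod_cast isRoot_charPoly_iff.mp hz
  -- Outside the open interval from `-(b-1)` to `0` all terms have the same sign.
  have h0 : x < 0 := by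
    by_contra h
    have hx : 0 < x := lt_of_le_of_ne (not_lt.mp h) fun h0 =>
      hne' 0 (Finset.mem_range.mpr hb) (by simp [← h0])
    exact (Finset.sum_pos (fun k _ => by positivity) hnonempty).ne' hsum'
  have h1 : -((b : ℝ) - 1) < x := by
    by_contra h
    refine (Finset.sum_neg (fun k hk => ?_) hnonempty).ne hsum'
    have hk' : (k : ℝ) + 1 ≤ b := by exact_mod_cast Finset.mem_range.mp hk
    exact one_div_neg.mpr (lt_of_le_of_ne (by linarith) (hne' k hk))
  have := abs_prod_add_lt_factorial h1 h0 hne'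
  rw [hz', abs_of_nonneg (by positivity)] at this
  exact this.false

/-- The leading `1` is the term `k = 0`, namely `x * (1/x)`. -/
theorem one_add_mul_harmonicDiff {K : Type*} [Field K] {b : ℕ} (hb : 1 ≤ b) {x : K} (hx : x ≠ 0) :
    1 + x * harmonicDiff x (b - 1) = x * ∑ k ∈ Finset.range b, 1 / (x + (k : K)) := by
  obtain ⟨m, rfl⟩ : ∃ m, b = m + 1 := ⟨b - 1, by omega⟩
  rw [Finset.sum_range_succ', harmonicDiff, ← Finset.Ico_add_one_right_eq_Icc,
    Finset.sum_Ico_eq_sum_range, mul_add, add_comm]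
  congr 1
  · simp [add_comm]
  · simp [hx]

theorem ne_zero_of_isRoot {b : ℕ} (hb : 1 ≤ b) {z : ℂ} (hz : (charPoly b).IsRoot z) : z ≠ 0 := by
  simpa using add_natCast_ne_zero_of_isRoot hz 0 (Finset.mem_range.mpr hb)

theorem one_add_mul_harmonicDiff_ne_zero {b : ℕ} (hb : 1 ≤ b) {z : ℂ}
    (hz : (charPoly b).IsRoot z) : 1 + z * harmonicDiff z (b - 1) ≠ 0 := by
  rw [one_add_mul_harmonicDiff hb (ne_zero_of_isRoot hb hz)]
  exact mul_ne_zero (ne_zero_of_isRoot hb hz) (sum_inv_ne_zero_of_isRoot hb hz)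

theorem mul_eval_derivative_charPoly {b : ℕ} (hb : 1 ≤ b) {z : ℂ} (hz : (charPoly b).IsRoot z) :
    z * (derivative (charPoly b)).eval z =
      ((b - 1).factorial : ℂ) * (1 + z * harmonicDiff z (b - 1)) := by
  rw [charPoly, derivative_sub, derivative_C, sub_zero,
    eval_derivative_ascPochhammer _ _ (add_natCast_ne_zero_of_isRoot hz),
    ascPochhammer_eval_eq_prod, isRoot_charPoly_iff.mp hz,
    one_add_mul_harmonicDiff hb (ne_zero_of_isRoot hb hz)]
  ring

theorem eval_derivative_charPoly_ne_zero {b : ℕ} (hb : 1 ≤ b) {z : ℂ}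
    (hz : (charPoly b).IsRoot z) : (derivative (charPoly b)).eval z ≠ 0 := by
  refine right_ne_zero_of_mul (a := z) ?_
  rw [mul_eval_derivative_charPoly hb hz]
  exact mul_ne_zero (by exact_mod_cast Nat.factorial_ne_zero _)
    (one_add_mul_harmonicDiff_ne_zero hb hz)

theorem rootMultiplicity_charPoly {b : ℕ} (hb : 1 ≤ b) {z : ℂ} (hz : (charPoly b).IsRoot z) :
    (charPoly b).rootMultiplicity z = 1 := by
  have hne := (monic_charPoly hb).ne_zero
  refine le_antisymm (not_lt.mp fun h => ?_) ((rootMultiplicity_pos hne).mpr hz)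
  exact eval_derivative_charPoly_ne_zero hb hz
    ((one_lt_rootMultiplicity_iff_isRoot hne).mp h).2

theorem nodup_roots_charPoly {b : ℕ} (hb : 1 ≤ b) : (charPoly b).roots.Nodup := by
  refine Multiset.nodup_iff_count_le_one.mpr fun z => ?_
  rw [count_roots]
  by_cases hz : (charPoly b).IsRoot z
  · exact (rootMultiplicity_charPoly hb hz).le
  · rw [rootMultiplicity_eq_zero hz]
    exact zero_le_one

theorem mem_roots_charPoly {b : ℕ} (hb : 1 ≤ b) {z : ℂ} :
    z ∈ (charPoly b).roots.toFinset ↔ (charPoly b).IsRoot z := by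
  rw [Multiset.mem_toFinset, mem_roots (monic_charPoly hb).ne_zero]

theorem card_roots_charPoly {b : ℕ} (hb : 1 ≤ b) : (charPoly b).roots.toFinset.card = b := by
  rw [Multiset.toFinset_card_of_nodup (nodup_roots_charPoly hb),
    ← (IsAlgClosed.splits (charPoly b)).natDegree_eq_card_roots, natDegree_charPoly]

theorem nodal_roots_charPoly {b : ℕ} (hb : 1 ≤ b) :
    Lagrange.nodal (charPoly b).roots.toFinset id = charPoly b := by
  conv_rhs => rw [(IsAlgClosed.splits (charPoly b)).eq_prod_roots_of_monic (monic_charPoly hb)]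
  rw [Lagrange.nodal, Finset.prod, Multiset.toFinset_val, (nodup_roots_charPoly hb).dedup]
  rfl

/-- Partial fractions of `q / charPoly b` at `0`. -/
theorem sum_eval_div_roots_charPoly {b : ℕ} (hb : 1 ≤ b) {q : ℂ[X]} (hq : q.degree < b) :
    ∑ z ∈ (charPoly b).roots.toFinset, 1 / (1 + z * harmonicDiff z (b - 1)) * q.eval z =
      q.eval 0 := by
  -- With `p = charPoly b`, interpolation at its roots gives `q(0) = p(0) ∑ q(z) / (p'(z) (0 - z))`.
  -- Since `p(0) = -(b-1)!`, the coefficient of `q(z)` is `(b-1)! / (z p'(z))`.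
  have hint := Lagrange.eq_interpolate (s := (charPoly b).roots.toFinset) (v := id)
    (Set.injOn_id _) (f := q) (by rwa [card_roots_charPoly hb])
  have hp0 : (charPoly b).eval 0 = -((b - 1).factorial : ℂ) := by
    rw [eval_charPoly, Finset.prod_eq_zero (Finset.mem_range.mpr hb) (by simp), zero_sub]
  conv_rhs => rw [hint, Lagrange.eval_interpolate_not_at_node (v := id) _ (fun z hz =>
    (ne_zero_of_isRoot hb ((mem_roots_charPoly hb).mp hz)).symm), nodal_roots_charPoly hb, hp0,
    Finset.mul_sum]
  refine Finset.sum_congr rfl fun z hz => ?_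
  have hz' := (mem_roots_charPoly hb).mp hz
  have h1 := ne_zero_of_isRoot hb hz'
  have h2 := eval_derivative_charPoly_ne_zero hb hz'
  have h3 : ((b - 1).factorial : ℂ) ≠ 0 := by exact_mod_cast Nat.factorial_ne_zero _
  rw [Lagrange.nodalWeight_eq_eval_derivative_nodal hz, nodal_roots_charPoly hb,
    eq_div_of_mul_eq h3 ((mul_comm _ _).trans (mul_eval_derivative_charPoly hb hz').symm)]
  simp only [id]
  field_simp
  ring

end CharPoly

/-! ### Eigenweights and the exact formula -/

section ExactFormula

/-- A left eigenvector, for the eigenvalue `x`, of the out-degree dynamics. -/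
def eigenWeight {K : Type*} [Field K] (x : K) (d : ℕ) : K :=
  (∏ k ∈ Finset.range (d - 1), (x + 1 + k)) / ((d - 1).factorial : K)

theorem eigenWeight_succ {K : Type*} [Field K] [CharZero K] (x : K) {d : ℕ} (hd : d ≠ 0) :
    (d : K) * (eigenWeight x (d + 1) - eigenWeight x d) = x * eigenWeight x d := by
  obtain ⟨e, rfl⟩ := Nat.exists_eq_succ_of_ne_zero hd
  have h1 : ((e.factorial : ℕ) : K) ≠ 0 := Nat.cast_ne_zero.mpr e.factorial_ne_zero
  have h2 : (e : K) + 1 ≠ 0 := Nat.cast_add_one_ne_zero e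
  simp only [eigenWeight, Nat.succ_eq_add_one, Nat.add_sub_cancel, Finset.prod_range_succ,
    Nat.factorial_succ, Nat.cast_mul, Nat.cast_add, Nat.cast_one]
  field_simp
  ring

/-- This closing condition of the eigenvector recursion is the characteristic equation divided by
`(b-1)!`. -/
theorem eigenWeight_top {b : ℕ} (hb : 1 ≤ b) {z : ℂ} (hz : (charPoly b).IsRoot z) :
    z * eigenWeight z b = 1 := by
  have h3 : ((b - 1).factorial : ℂ) ≠ 0 := by exact_mod_cast Nat.factorial_ne_zero _
  have := isRoot_charPoly_iff.mp hz
  obtain ⟨m, rfl⟩ : ∃ m, b = m + 1 := ⟨b - 1, by omega⟩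
  rw [eigenWeight, ← mul_div_assoc, div_eq_one_iff_eq h3, ← this, Finset.prod_range_succ',
    mul_comm]
  simp [add_assoc, add_comm (1 : ℂ)]

/-- As a function of `z`, the eigenweight at `d` is a polynomial of degree `d - 1 < b` with value
`1` at `0`, so the partial fraction identity applies. -/
theorem sum_eigenWeight {b : ℕ} (hb : 1 ≤ b) {d : ℕ} (hdb : d ≤ b) :
    ∑ z ∈ (charPoly b).roots.toFinset,
      1 / (1 + z * harmonicDiff z (b - 1)) * eigenWeight z d = 1 := by
  have hc : ∀ z : ℂ, ((ascPochhammer ℂ (d - 1)).comp (Polynomial.X + Polynomial.C 1)).eval z =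
      ∏ k ∈ Finset.range (d - 1), (z + 1 + k) := by
    intro z
    simp [Polynomial.eval_comp, ascPochhammer_eval_eq_prod]
  have hdeg : ((ascPochhammer ℂ (d - 1)).comp (Polynomial.X + Polynomial.C 1)).degree < b := by
    refine Polynomial.degree_le_natDegree.trans_lt ?_
    rw [Polynomial.natDegree_comp, ascPochhammer_natDegree, Polynomial.natDegree_X_add_C]
    exact_mod_cast (by omega : (d - 1) * 1 < b)
  have h3 : ((d - 1).factorial : ℂ) ≠ 0 := by exact_mod_cast Nat.factorial_ne_zero _
  have := sum_eval_div_roots_charPoly hb hdeg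
  simp only [hc] at this
  simp only [eigenWeight, ← mul_div_assoc, ← Finset.sum_div]
  rw [this, div_eq_one_iff_eq h3, ← Finset.prod_range_add_one_eq_factorial]
  push_cast
  simp [add_comm]

theorem choose_eq_prod (n : ℕ) (z : ℂ) :
    Ring.choose (((n + 1 : ℕ) : ℂ) + z - 1) n =
      ∏ k ∈ Finset.range n, (1 + z / ((k + 1 : ℕ) : ℂ)) := by
  rw [Ring.choose_eq_smul, Polynomial.descPochhammer_smeval_eq_ascPochhammer,
    show ((n + 1 : ℕ) : ℂ) + z - 1 - n + 1 = z + 1 by push_cast; ring,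
    Polynomial.ascPochhammer_smeval_eq_eval, ascPochhammer_eval_eq_prod,
    ← Finset.prod_range_add_one_eq_factorial, smul_eq_mul, Nat.cast_prod, ← Finset.prod_inv_distrib,
    ← Finset.prod_mul_distrib]
  refine Finset.prod_congr rfl fun k _ => ?_
  have : ((k + 1 : ℕ) : ℂ) ≠ 0 := Nat.cast_ne_zero.mpr k.succ_ne_zero
  field_simp
  push_cast
  ring

theorem expectedPathLength_eq_sum {b : ℕ} (hb : 1 ≤ b) (n : ℕ) :
    (expectedPathLength b (n + 1) : ℂ) = ∑ z ∈ (charPoly b).roots.toFinset,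
      1 / (1 + z * harmonicDiff z (b - 1)) *
        ∏ k ∈ Finset.range n, (1 + z / ((k + 1 : ℕ) : ℂ)) := by
  rw [expectedPathLength_eq_mean, Network.mean_congr hb n _ _ fun G _ hd =>
    Network.pathSum_linearCombination (charPoly b).roots.toFinset G
      (fun z => 1 / (1 + z * harmonicDiff z (b - 1))) eigenWeight _ b hd
      (fun d _ hdb => (sum_eigenWeight hb hdb).symm) (n + 1) Network.source, Network.mean_sum]
  refine Finset.sum_congr rfl fun z hz => ?_
  have h1 : eigenWeight z 1 = 1 := by simp [eigenWeight]
  rw [Network.mean_const_mul, Network.mean_pathSum_eigen hb (lam := z)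
    (fun d h0 _ => eigenWeight_succ z h0)
    (h1.trans (eigenWeight_top hb ((mem_roots_charPoly hb).mp hz)).symm), h1, one_mul]

end ExactFormula

/-! ### Growth of the products via Euler's limit for Γ -/

section Asymptotics

open Filter Topology

theorem prod_one_add_div_eq (z : ℂ) (n : ℕ) :
    ∏ k ∈ Finset.range n, (1 + z / ((k + 1 : ℕ) : ℂ)) =
      (∏ k ∈ Finset.range n, (z + ((k + 1 : ℕ) : ℂ))) / (n.factorial : ℂ) := by
  rw [← Finset.prod_range_add_one_eq_factorial, Nat.cast_prod, ← Finset.prod_div_distrib]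
  refine Finset.prod_congr rfl fun k _ => ?_
  have : ((k + 1 : ℕ) : ℂ) ≠ 0 := Nat.cast_ne_zero.mpr k.succ_ne_zero
  field_simp
  ring

theorem tendsto_prod_one_add_div_aux {z : ℂ} (hz : z ≠ 0) :
    Tendsto (fun n : ℕ => (∏ k ∈ Finset.range n, (1 + z / ((k + 1 : ℕ) : ℂ))) / (n : ℂ) ^ z)
      atTop (𝓝 (Complex.Gamma (z + 1))⁻¹) := by
  -- `Complex.Gamma` takes the value `0` at its poles. There the product eventually contains a zero
  -- factor, and the claimed limit is `0⁻¹ = 0`. Elsewhere the quotient is `1/z` times the inverse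
  -- of `Complex.GammaSeq`.
  by_cases hG : Complex.Gamma z = 0
  · obtain ⟨m, rfl⟩ := (Complex.Gamma_eq_zero_iff z).mp hG
    obtain ⟨l, rfl⟩ : ∃ l, m = l + 1 := Nat.exists_eq_succ_of_ne_zero (by rintro rfl; simp at hz)
    rw [show -((l + 1 : ℕ) : ℂ) + 1 = -(l : ℂ) by push_cast; ring, Complex.Gamma_neg_nat_eq_zero,
      inv_zero]
    refine tendsto_const_nhds.congr' ?_
    filter_upwards [eventually_gt_atTop l] with n hn
    have : ((l + 1 : ℕ) : ℂ) ≠ 0 := Nat.cast_ne_zero.mpr l.succ_ne_zero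
    rw [Finset.prod_eq_zero (Finset.mem_range.mpr hn) (by rw [neg_div, div_self this]; ring),
      zero_div]
  · rw [Complex.Gamma_add_one z hz, mul_inv]
    refine (((Complex.GammaSeq_tendsto_Gamma z).inv₀ hG).const_mul z⁻¹).congr fun n => ?_
    have h1 : (n.factorial : ℂ) ≠ 0 := by exact_mod_cast n.factorial_ne_zero
    rw [Complex.GammaSeq, prod_one_add_div_eq, Finset.prod_range_succ', inv_div]
    simp only [Nat.cast_zero, add_zero]
    field_simp

/-- The product with `n - 1` factors differs from the one with `n` by the factor `1 + z/n`, which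
tends to `1`. -/
theorem tendsto_prod_one_add_div {z : ℂ} (hz : z ≠ 0) :
    Tendsto (fun n : ℕ => (∏ k ∈ Finset.range (n - 1), (1 + z / ((k + 1 : ℕ) : ℂ))) / (n : ℂ) ^ z)
      atTop (𝓝 (Complex.Gamma (z + 1))⁻¹) := by
  have h1 : Tendsto (fun n : ℕ => 1 + z / (n : ℂ)) atTop (𝓝 1) := by
    simpa using (tendsto_const_div_atTop_nhds_zero_nat z).const_add 1
  have h2 := (tendsto_prod_one_add_div_aux hz).div h1 one_ne_zero
  rw [div_one] at h2
  refine h2.congr' ?_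
  filter_upwards [h1.eventually_ne one_ne_zero, eventually_ge_atTop 1] with n hn hn1
  obtain ⟨m, rfl⟩ : ∃ m, n = m + 1 := ⟨n - 1, by omega⟩
  simp only [Pi.div_apply, Nat.add_sub_cancel, Finset.prod_range_succ]
  rw [div_right_comm, mul_div_assoc, div_self hn, mul_one]

theorem tendsto_natCast_cpow_of_re_neg {w : ℂ} (hw : w.re < 0) :
    Tendsto (fun n : ℕ => (n : ℂ) ^ w) atTop (𝓝 0) := by
  rw [tendsto_zero_iff_norm_tendsto_zero]
  have h := (tendsto_rpow_neg_atTop (neg_pos.mpr hw)).comp tendsto_natCast_atTop_atTop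
  refine h.congr' ?_
  filter_upwards [eventually_gt_atTop 0] with n hn
  rw [Complex.norm_natCast_cpow_of_pos hn, neg_neg]
  rfl

end Asymptotics

/-! ### The dominant positive root -/

section PositiveRoot

open Filter Topology

theorem isRoot_charPoly_ofReal_iff {b : ℕ} {x : ℝ} :
    (charPoly b).IsRoot (x : ℂ) ↔ ∏ k ∈ Finset.range b, (x + k) = ((b - 1).factorial : ℝ) := by
  rw [isRoot_charPoly_iff]
  exact_mod_cast Iff.rfl

theorem prod_add_lt_prod_add {b : ℕ} (hb : 1 ≤ b) {x y : ℝ} (hx : 0 < x) (hxy : x < y) :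
    ∏ k ∈ Finset.range b, (x + k) < ∏ k ∈ Finset.range b, (y + k) :=
  Finset.prod_lt_prod_of_nonempty (fun k _ => by positivity) (fun k _ => by linarith)
    ⟨0, Finset.mem_range.mpr hb⟩

theorem exists_pos_root_charPoly {b : ℕ} (hb : 2 ≤ b) :
    ∃ ρ : ℝ, 0 < ρ ∧ ρ < 1 ∧ (charPoly b).IsRoot (ρ : ℂ) := by
  have h0 : ∏ k ∈ Finset.range b, ((0 : ℝ) + k) = 0 :=
    Finset.prod_eq_zero (Finset.mem_range.mpr (by omega : 0 < b)) (by simp)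
  have h1 : ∏ k ∈ Finset.range b, ((1 : ℝ) + k) = (b.factorial : ℝ) := by
    rw [← Finset.prod_range_add_one_eq_factorial]
    push_cast
    simp [add_comm]
  -- The value at `1` is `b!`; strictness, and hence a root below `1`, needs `b ≥ 2`.
  have h2 : ((b - 1).factorial : ℝ) < b.factorial := by
    exact_mod_cast (Nat.factorial_lt (by omega)).mpr (by omega)
  have hcont : ContinuousOn (fun x : ℝ => ∏ k ∈ Finset.range b, (x + k)) (Set.Icc 0 1) := by
    fun_prop
  obtain ⟨ρ, hρ, hroot⟩ := intermediate_value_Ioo zero_le_one hcont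
    (show ((b - 1).factorial : ℝ) ∈ Set.Ioo _ _ by
      simp only [h0, h1]
      exact ⟨by exact_mod_cast Nat.factorial_pos _, h2⟩)
  exact ⟨ρ, hρ.1, hρ.2, isRoot_charPoly_ofReal_iff.mpr hroot⟩

theorem pos_root_charPoly_unique {b : ℕ} (hb : 1 ≤ b) {x y : ℝ} (hx : 0 < x) (hy : 0 < y)
    (hxr : (charPoly b).IsRoot (x : ℂ)) (hyr : (charPoly b).IsRoot (y : ℂ)) : x = y := by
  rw [isRoot_charPoly_ofReal_iff] at hxr hyr
  rcases lt_trichotomy x y with h | h | h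
  · exact absurd (hxr.trans hyr.symm) (prod_add_lt_prod_add hb hx h).ne
  · exact h
  · exact absurd (hyr.trans hxr.symm) (prod_add_lt_prod_add hb hy h).ne

/-- The positive root dominates all other roots. -/
theorem re_lt_of_isRoot {b : ℕ} (hb : 1 ≤ b) {ρ : ℝ} (hρ : 0 < ρ)
    (hroot : (charPoly b).IsRoot (ρ : ℂ)) {z : ℂ} (hz : (charPoly b).IsRoot z) (hne : z ≠ ρ) :
    z.re < ρ := by
  by_contra hge
  rw [not_lt] at hge
  have hle : ∀ k : ℕ, ρ + k ≤ ‖z + (k : ℂ)‖ := fun k =>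
    le_trans (by simpa using hge) (Complex.re_le_norm (z + (k : ℂ)))
  -- If `|z| = ρ ≤ z.re`, then `z = ρ`. So the factor `k = 0` is strict, and the products over `k`
  -- cannot both have absolute value `(b-1)!`.
  have hlt : ρ + (0 : ℕ) < ‖z + ((0 : ℕ) : ℂ)‖ := by
    refine lt_of_le_of_ne (hle 0) fun h => hne ?_
    simp only [Nat.cast_zero, add_zero] at h
    have h1 : z.re = ρ := le_antisymm (h ▸ Complex.re_le_norm z) hge
    have h2 := Complex.normSq_eq_norm_sq z
    rw [← h, Complex.normSq_apply, h1] at h2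
    have h3 : z.im = 0 := by nlinarith
    exact Complex.ext (by simpa using h1) (by simpa using h3)
  have := Finset.prod_lt_prod (s := Finset.range b) (f := fun k : ℕ => ρ + k)
    (g := fun k : ℕ => ‖z + (k : ℂ)‖) (fun k _ => by positivity) (fun k _ => hle k)
    ⟨0, Finset.mem_range.mpr hb, hlt⟩
  rw [← norm_prod, isRoot_charPoly_iff.mp hz, isRoot_charPoly_ofReal_iff.mp hroot] at this
  simp at this

theorem tendsto_expectedPathLength_div {b : ℕ} (hb : 1 ≤ b) {ρ : ℝ} (hρ : 0 < ρ)
    (hroot : (charPoly b).IsRoot (ρ : ℂ)) :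
    Tendsto (fun n : ℕ => expectedPathLength b n / (n : ℝ) ^ ρ) atTop
      (𝓝 (1 / (1 + ρ * harmonicDiff ρ (b - 1)) * (Real.Gamma (ρ + 1))⁻¹)) := by
  -- After division by `n^ρ`, the term of `z` carries the factor `n^(z-ρ)`, which vanishes in the
  -- limit unless `z = ρ`.
  have hterm : ∀ z ∈ (charPoly b).roots.toFinset, Tendsto (fun n : ℕ =>
      1 / (1 + z * harmonicDiff z (b - 1)) *
        ((∏ k ∈ Finset.range (n - 1), (1 + z / ((k + 1 : ℕ) : ℂ))) / (n : ℂ) ^ z *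
          (n : ℂ) ^ (z - ρ))) atTop
      (𝓝 (1 / (1 + z * harmonicDiff z (b - 1)) * ((Complex.Gamma (z + 1))⁻¹ *
        if z = ρ then 1 else 0))) := by
    intro z hz
    have hz' := (mem_roots_charPoly hb).mp hz
    refine ((tendsto_prod_one_add_div (ne_zero_of_isRoot hb hz')).mul ?_).const_mul _
    split_ifs with h
    · simp [h]
    · refine tendsto_natCast_cpow_of_re_neg ?_
      simpa using re_lt_of_isRoot hb hρ hroot hz' h
  have hsum := tendsto_finsetSum _ hterm
  simp only [mul_ite, mul_one, mul_zero] at hsum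
  rw [Finset.sum_ite_eq' _ (ρ : ℂ), if_pos ((mem_roots_charPoly hb).mpr hroot)] at hsum
  have hre := (Complex.continuous_re.tendsto _).comp hsum
  have hlim : 1 / (1 + (ρ : ℂ) * harmonicDiff (ρ : ℂ) (b - 1)) * (Complex.Gamma (ρ + 1))⁻¹ =
      ((1 / (1 + ρ * harmonicDiff ρ (b - 1)) * (Real.Gamma (ρ + 1))⁻¹ : ℝ) : ℂ) := by
    rw [harmonicDiff, harmonicDiff]
    push_cast [← Complex.Gamma_ofReal]
    rfl
  rw [hlim, Complex.ofReal_re] at hre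
  refine hre.congr' ?_
  filter_upwards [eventually_ge_atTop 1] with n hn
  obtain ⟨m, rfl⟩ : ∃ m, n = m + 1 := ⟨n - 1, by omega⟩
  rw [Function.comp_apply, ← Complex.ofReal_re (expectedPathLength b (m + 1) / _)]
  congr 1
  have hm : ((m + 1 : ℕ) : ℂ) ≠ 0 := Nat.cast_ne_zero.mpr m.succ_ne_zero
  rw [Complex.ofReal_div, expectedPathLength_eq_sum hb, Complex.ofReal_cpow (Nat.cast_nonneg _),
    Complex.ofReal_natCast, Finset.sum_div]
  refine Finset.sum_congr rfl fun z _ => ?_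
  have h1 : ((m + 1 : ℕ) : ℂ) ^ z ≠ 0 := fun h => hm ((Complex.cpow_eq_zero_iff _ _).mp h).1
  rw [Complex.cpow_sub _ _ hm, Nat.add_sub_cancel, div_mul_div_cancel₀ h1, mul_div_assoc]

end PositiveRoot

theorem mainTheorem10 (b : ℕ) (hb : 2 ≤ b) :
    -- the characteristic equation has `b` different roots, all of them simple
    (charPoly b).roots.toFinset.card = b ∧
    (∀ z ∈ (charPoly b).roots.toFinset, (charPoly b).rootMultiplicity z = 1) ∧
    -- no division by zero occurs in the coefficients
    (∀ z ∈ (charPoly b).roots.toFinset,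
      (∀ k ∈ Finset.Icc 1 (b - 1), z + (k : ℂ) ≠ 0) ∧ 1 + z * harmonicDiff z (b - 1) ≠ 0) ∧
    -- the expectation exists and is given by the exact formula
    (∀ n : ℕ, 1 ≤ n →
      MeasureTheory.Integrable (fun m : ℕ => (m : ℝ)) (Network.pathLengthLaw b n).toMeasure ∧
      (expectedPathLength b n : ℂ) =
        ∑ z ∈ (charPoly b).roots.toFinset,
          1 / (1 + z * harmonicDiff z (b - 1)) * Ring.choose ((n : ℂ) + z - 1) (n - 1)) ∧
    -- the unique positive real root lies in `(0, 1)` and determines the asymptotic behaviour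
    ∃ ρ : ℝ, 0 < ρ ∧ ρ < 1 ∧
      (∀ x : ℝ, 0 < x → ((charPoly b).IsRoot (x : ℂ) ↔ x = ρ)) ∧
      Asymptotics.IsEquivalent Filter.atTop
        (fun n : ℕ => expectedPathLength b n)
        (fun n : ℕ => 1 / (1 + ρ * harmonicDiff ρ (b - 1)) *
          ((n : ℝ) ^ ρ / Real.Gamma (ρ + 1))) := by
  have hb1 : 1 ≤ b := by omega
  refine ⟨card_roots_charPoly hb1,
    fun z hz => rootMultiplicity_charPoly hb1 ((mem_roots_charPoly hb1).mp hz),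
    fun z hz => ⟨fun k hk => ?_,
      one_add_mul_harmonicDiff_ne_zero hb1 ((mem_roots_charPoly hb1).mp hz)⟩,
    fun n hn => ?_, ?_⟩
  · have := Finset.mem_Icc.mp hk
    exact add_natCast_ne_zero_of_isRoot ((mem_roots_charPoly hb1).mp hz) k
      (Finset.mem_range.mpr (by omega))
  · obtain ⟨m, rfl⟩ : ∃ m, n = m + 1 := ⟨n - 1, by omega⟩
    refine ⟨integrable_pathLengthLaw b m, ?_⟩
    rw [expectedPathLength_eq_sum hb1]
    exact Finset.sum_congr rfl fun z _ => by rw [Nat.add_sub_cancel, choose_eq_prod]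
  · obtain ⟨ρ, h0, h1, hroot⟩ := exists_pos_root_charPoly hb
    refine ⟨ρ, h0, h1, fun x hx => ⟨fun h => pos_root_charPoly_unique hb1 hx h0 h hroot,
      fun h => h ▸ hroot⟩, ?_⟩
    have hD : 0 < 1 + ρ * harmonicDiff ρ (b - 1) := by
      unfold harmonicDiff
      positivity
    have hG : 0 < Real.Gamma (ρ + 1) := Real.Gamma_pos_of_pos (by linarith)
    have hC : 1 / (1 + ρ * harmonicDiff ρ (b - 1)) * (Real.Gamma (ρ + 1))⁻¹ ≠ 0 := by positivity
    have hpow : ∀ᶠ n : ℕ in Filter.atTop, (n : ℝ) ^ ρ ≠ 0 := by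
      filter_upwards [Filter.eventually_gt_atTop 0] with n hn
      positivity
    rw [Asymptotics.isEquivalent_iff_tendsto_one (hpow.mono fun n hn => by positivity)]
    have h := (tendsto_expectedPathLength_div hb1 h0 hroot).div_const
      (1 / (1 + ρ * harmonicDiff ρ (b - 1)) * (Real.Gamma (ρ + 1))⁻¹)
    rw [div_self hC] at h
    refine h.congr fun n => ?_
    simp only [Pi.div_apply]
    rw [div_div]
    congr 1
    ring
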